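/- Let $G$ be a finite simple graph with vertex set $[n]=\{1,\dots,n\}$, let $K$ be a field, $S=K[x_1,\dots,x_n]$, and let $I(G)\subseteq S$ be the edge ideal of $G$, generated by the products $x_ix_j$ with $\{i,j\}$ an edge of $G$. For $i\in[n]$ let $N(i)$ be the set of vertices adjacent to $i$, and let $G^{(i)}$ be the complementary graph of the restriction of $G$ to $N(i)$: its vertex set is $N(i)$, and distinct $j,k\in N(i)$ are adjacent in $G^{(i)}$ if and only if $\{j,k\}$ is not an edge of $G$. A separation of a squarefree monomial ideal $I\subseteq S$ for the variable $x_i$ is a monomial ideal $J\subseteq S[y]$, $y$ an indeterminate over $S$, such that (i) $I$ is the image of $J$ under the $K$-algebra homomorphism $S[y]\to S$ with $y\mapsto x_i$ and $x_j\mapsto x_j$ for all $j$; (ii) $x_i$ divides some minimal monomial generator of $J$, and $y$ divides some minimal monomial generator of $J$; (iii) $y-x_i$ is a non-zero-divisor of $S[y]/J$. The ideal $I$ is inseparable if it admits no separation for any of the variables $x_1,\dots,x_n$, and the graph $G$ is inseparable if $I(G)$ is. For a monomial ideal $I\subseteq S$, $T^1(S/I)$ denotes the cokernel of the map $\operatorname{Der}_K(S)\to\operatorname{Hom}_S(I,S/I)$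 that sends a $K$-derivation $\partial$ of $S$ to $f\mapsto \partial f+I$. It is a $\mathbb Z^n$-graded $S$-module: its component of degree $c\in\mathbb Z^n$ is the image of the set of those $\varphi\in\operatorname{Hom}_S(I,S/I)$ that map $I_d$ into $(S/I)_{d+c}$ for all $d\in\mathbb Z^n$. Let $e_i$ denote the $i$-th canonical basis vector of $\mathbb Z^n$. **Theorem.** The following conditions are equivalent: (a) the graph $G$ is inseparable; (b) $G^{(i)}$ is connected for all $i\in[n]$ (where the graph without vertices counts as connected); (c) $T^1(S/I(G))_{-e_i}=0$ for all $i\in[n]$. -/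

import Mathlib

/-! ## Monomial ideals and separations -/

/-- An ideal of a polynomial ring over a field is a monomial ideal if it is generated by
monomials. -/
def IsMonomialIdeal {σ K : Type*} [Field K] (J : Ideal (MvPolynomial σ K)) : Prop :=
  ∃ s : Set (σ →₀ ℕ), J = Ideal.span ((fun a => MvPolynomial.monomial a (1 : K)) '' s)

/-- `x ^ a` is a minimal (monomial) generator of the monomial ideal `J`: it lies in `J`, and no
proper divisor of it that is a monomial lies in `J`. -/
def IsMinimalGenerator {σ K : Type*} [Field K] (J : Ideal (MvPolynomial σ K))
    (a : σ →₀ ℕ) : Prop :=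
  Minimal (fun b : σ →₀ ℕ => MvPolynomial.monomial b (1 : K) ∈ J) a

/-- For `S = K[x_j : j ∈ σ]`, the ring `S[y]` is modelled by `MvPolynomial (Option σ) K`, with
`y = X none` and `x_j = X (some j)`. This is the `K`-algebra homomorphism `S[y] → S` with
`y ↦ x_i` and `x_j ↦ x_j`. -/
noncomputable def substHom {σ : Type*} (K : Type*) [Field K] (i : σ) :
    MvPolynomial (Option σ) K →ₐ[K] MvPolynomial σ K :=
  MvPolynomial.aeval (fun j : Option σ => MvPolynomial.X (j.getD i))

/-- The monomial ideal `J` of `S[y]` is a separation of the ideal `I` of `S` for the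
variable `x_i`. -/
structure IsSeparation {σ K : Type*} [Field K] (I : Ideal (MvPolynomial σ K)) (i : σ)
    (J : Ideal (MvPolynomial (Option σ) K)) : Prop where
  isMonomialIdeal : IsMonomialIdeal J
  map_eq : Ideal.map (substHom K i) J = I
  dvd_x : ∃ a, IsMinimalGenerator J a ∧ a (some i) ≠ 0
  dvd_y : ∃ a, IsMinimalGenerator J a ∧ a none ≠ 0
  nonZeroDivisor :
    Ideal.Quotient.mk J (MvPolynomial.X none - MvPolynomial.X (some i)) ∈
      nonZeroDivisors (MvPolynomial (Option σ) K ⧸ J)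

/-- A (squarefree monomial) ideal is inseparable if it admits no separation, for any variable. -/
def IsInseparable {σ K : Type*} [Field K] (I : Ideal (MvPolynomial σ K)) : Prop :=
  ¬ ∃ (i : σ) (J : Ideal (MvPolynomial (Option σ) K)), IsSeparation I i J

/-! ## The first cotangent functor and its multigraded components -/

/-- The natural map `Der_K(S) → Hom_S(I, S/I)`, sending `∂` to `f ↦ ∂ f + I`. -/
noncomputable def deltaStar {σ K : Type*} [Field K] (I : Ideal (MvPolynomial σ K)) :
    Derivation K (MvPolynomial σ K) (MvPolynomial σ K) →ₗ[MvPolynomial σ K]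
      (I →ₗ[MvPolynomial σ K] MvPolynomial σ K ⧸ I) where
  toFun D :=
    { toFun := fun f => Ideal.Quotient.mk I (D (f : MvPolynomial σ K))
      map_add' := fun f g => by simp
      map_smul' := fun s f => by
        have h : Ideal.Quotient.mk I (f : MvPolynomial σ K) = 0 :=
          Ideal.Quotient.eq_zero_iff_mem.mpr f.2
        simp [h]
        rfl }
  map_add' D E := by ext f; simp
  map_smul' s D := by
    ext f
    simp
    rfl

/-- `T¹(S/I)`, the cokernel of `Der_K(S) → Hom_S(I, S/I)`. -/
abbrev T1 {σ K : Type*} [Field K] (I : Ideal (MvPolynomial σ K)) : Type _ :=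
  (I →ₗ[MvPolynomial σ K] MvPolynomial σ K ⧸ I) ⧸ LinearMap.range (deltaStar I)

/-- The component `S_d` of multidegree `d` of `S = K[x_j : j ∈ σ]`, where `deg x_j` is the `j`-th
canonical basis vector. -/
noncomputable def polyComponent {σ : Type*} (K : Type*) [Field K] (d : σ →₀ ℤ) :
    Submodule K (MvPolynomial σ K) :=
  MvPolynomial.weightedHomogeneousSubmodule K (fun j : σ => Finsupp.single j (1 : ℤ)) d

/-- The component `(S/I)_d` of `S/I`: the image of `S_d`. -/
noncomputable def quotComponent {σ K : Type*} [Field K] (I : Ideal (MvPolynomial σ K))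
    (d : σ →₀ ℤ) : Submodule K (MvPolynomial σ K ⧸ I) :=
  (polyComponent K d).map (Ideal.Quotient.mkₐ K I).toLinearMap

/-- The component `Hom_S(I, S/I)_c`: the homomorphisms that map `I_d = I ∩ S_d` into
`(S/I)_{d + c}` for every multidegree `d`. -/
def homComponent {σ K : Type*} [Field K] (I : Ideal (MvPolynomial σ K)) (c : σ →₀ ℤ) :
    Submodule K (I →ₗ[MvPolynomial σ K] MvPolynomial σ K ⧸ I) where
  carrier := {φ | ∀ (d : σ →₀ ℤ) (f : I), (f : MvPolynomial σ K) ∈ polyComponent K d →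
    φ f ∈ quotComponent I (d + c)}
  add_mem' h₁ h₂ d f hf := add_mem (h₁ d f hf) (h₂ d f hf)
  zero_mem' _ _ _ := zero_mem _
  smul_mem' r _ h d f hf := Submodule.smul_mem _ r (h d f hf)

/-- The component `T¹(S/I)_c` (for a monomial ideal `I`): the image of `Hom_S(I, S/I)_c` in
the cokernel. -/
noncomputable def T1Component {σ K : Type*} [Field K] (I : Ideal (MvPolynomial σ K))
    (c : σ →₀ ℤ) : Submodule K (T1 I) :=
  (homComponent I c).map ((LinearMap.range (deltaStar I)).mkQ.restrictScalars K)

/-! ## Graphs -/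

/-- The edge ideal of `G`, generated by the products `x_i x_j` with `{i, j}` an edge of `G`. -/
noncomputable def edgeIdeal {V : Type*} (K : Type*) [Field K] (G : SimpleGraph V) :
    Ideal (MvPolynomial V K) :=
  Ideal.span {f | ∃ i j, G.Adj i j ∧ f = MvPolynomial.X i * MvPolynomial.X j}

/-- `G` is inseparable (over `K`) if its edge ideal is. -/
def IsInseparableGraph {V : Type*} (K : Type*) [Field K] (G : SimpleGraph V) : Prop :=
  IsInseparable (edgeIdeal K G)

/-- The complementary graph of the restriction of `G` to the neighbourhood `N(i)`. -/
def neighborCompl {V : Type*} (G : SimpleGraph V) (i : V) : SimpleGraph (G.neighborSet i) :=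
  (G.induce (G.neighborSet i))ᶜ

/-! A separation `J` for x_i yields a first-order deformation of degree -e_i: lift f ∈ I to F ∈ J
and set y = x_i in ∂F/∂y (`IsSeparation.deformation`). Regularity of y - x_i makes it well defined.
As `J` has minimal generators x_i x_u and y x_v (`IsSeparation.exists_edge`), it sends x_i x_u to 0
and x_i x_v to x_v. A derivation D inducing it would need the constant term of D x_i to be both 0
and 1, so vanishing of T¹ forces inseparability.

A homomorphism of degree -e_i sends x_i x_k to λ_k x_k and kills the edges avoiding i. Moreover λ_k
= λ_l unless kl is an edge (`eq_of_not_adj`). If G^(i) is connected, λ is therefore constant and the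
homomorphism is λ ∂/∂x_i.

If G^(i) is disconnected and A is a component, splitting i into a vertex with neighbours A and one
with the remaining neighbours gives a separation: A and N(i) \ A are completely joined in G, which
makes y - x_i regular (`mk_X_sub_X_mem_nonZeroDivisors`). -/

open MvPolynomial

/-! ### Separations and the deformations they induce. -/

section MonomialIdeals

variable {σ K : Type*} [Field K]

theorem IsMonomialIdeal.mem_iff {J : Ideal (MvPolynomial σ K)} (hJ : IsMonomialIdeal J)
    {f : MvPolynomial σ K} : f ∈ J ↔ ∀ m ∈ f.support, monomial m (1 : K) ∈ J := by
  classical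
  obtain ⟨s, rfl⟩ := hJ
  simp only [mem_ideal_span_monomial_image]
  refine forall₂_congr fun m _ => ?_
  simp [support_monomial]

/-- The exponent vector of the image of a monomial under `substHom`. -/
noncomputable def substExponent (i : σ) (m : Option σ →₀ ℕ) : σ →₀ ℕ :=
  m.mapDomain (fun j => j.getD i)

theorem substHom_eq_rename (i : σ) :
    substHom K i = rename (fun j : Option σ => j.getD i) := by
  apply algHom_ext
  intro j
  simp [substHom]

theorem substHom_monomial (i : σ) (m : Option σ →₀ ℕ) (c : K) :
    substHom K i (monomial m c) = monomial (substExponent i m) c := by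
  rw [substHom_eq_rename, rename_monomial, substExponent]

theorem substHom_X (i : σ) (j : Option σ) :
    substHom K i (X j) = X (j.getD i) := by
  simp [substHom]

theorem substHom_rename_some (i : σ) (f : MvPolynomial σ K) :
    substHom K i (rename some f) = f := by
  rw [substHom_eq_rename, rename_rename]
  exact rename_id_apply f

theorem substHom_surjective (i : σ) : Function.Surjective (substHom K i) :=
  fun f => ⟨_, substHom_rename_some i f⟩

theorem substExponent_mapDomain_some (i : σ) (m : σ →₀ ℕ) :
    substExponent i (m.mapDomain some) = m := by
  rw [substExponent, ← Finsupp.mapDomain_comp]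
  exact Finsupp.mapDomain_id

theorem substExponent_add (i : σ) (m n : Option σ →₀ ℕ) :
    substExponent i (m + n) = substExponent i m + substExponent i n :=
  Finsupp.mapDomain_add

theorem substExponent_single (i : σ) (j : Option σ) (n : ℕ) :
    substExponent i (Finsupp.single j n) = Finsupp.single (j.getD i) n :=
  Finsupp.mapDomain_single

/-- Modulo y - x_i every polynomial equals its specialization re-embedded by `rename some`, since
the two algebra maps agree on variables. -/
theorem dvd_of_substHom_eq_zero {i : σ} {F : MvPolynomial (Option σ) K}
    (hF : substHom K i F = 0) : X none - X (some i) ∣ F := by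
  rw [← Ideal.mem_span_singleton, ← Ideal.Quotient.eq_zero_iff_mem]
  set Q := Ideal.span {(X none - X (some i) : MvPolynomial (Option σ) K)}
  have h : ((Ideal.Quotient.mkₐ K Q).comp (rename some)).comp (substHom K i) =
      Ideal.Quotient.mkₐ K Q := by
    apply algHom_ext
    rintro (_ | j)
    · simp only [AlgHom.comp_apply, substHom_X, Option.getD_none, rename_X,
        Ideal.Quotient.mkₐ_eq_mk]
      refine (Ideal.Quotient.eq.mpr (Ideal.mem_span_singleton_self _)).symm
    · simp [substHom_X]
  have := DFunLike.congr_fun h F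
  simpa [hF] using this.symm

namespace IsSeparation

variable {I : Ideal (MvPolynomial σ K)} {i : σ} {J : Ideal (MvPolynomial (Option σ) K)}

theorem substHom_mem (h : IsSeparation I i J) {F : MvPolynomial (Option σ) K} (hF : F ∈ J) :
    substHom K i F ∈ I :=
  h.map_eq ▸ Ideal.mem_map_of_mem _ hF

theorem exists_lift (h : IsSeparation I i J) {f : MvPolynomial σ K} (hf : f ∈ I) :
    ∃ F ∈ J, substHom K i F = f := by
  rw [← h.map_eq] at hf
  exact (Ideal.mem_map_iff_of_surjective _ (substHom_surjective i)).mp hf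

theorem mem_of_mul_mem (h : IsSeparation I i J) {F : MvPolynomial (Option σ) K}
    (hF : (X none - X (some i)) * F ∈ J) : F ∈ J := by
  have := h.nonZeroDivisor
  rw [mem_nonZeroDivisors_iff_right] at this
  rw [← Ideal.Quotient.eq_zero_iff_mem]
  apply this
  rw [← map_mul, Ideal.Quotient.eq_zero_iff_mem, mul_comm]
  exact hF

theorem exists_mul_eq (h : IsSeparation I i J) {F : MvPolynomial (Option σ) K} (hF : F ∈ J)
    (h0 : substHom K i F = 0) : ∃ H ∈ J, F = (X none - X (some i)) * H := by
  obtain ⟨H, rfl⟩ := dvd_of_substHom_eq_zero h0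
  exact ⟨H, h.mem_of_mul_mem hF, rfl⟩

theorem exists_monomial_lift (h : IsSeparation I i J) {w : σ →₀ ℕ}
    (hw : monomial w (1 : K) ∈ I) :
    ∃ m : Option σ →₀ ℕ, monomial m (1 : K) ∈ J ∧ substExponent i m = w := by
  classical
  obtain ⟨F, hF, hFw⟩ := h.exists_lift hw
  have hc : coeff w (substHom K i F) ≠ 0 := by rw [hFw]; simp
  rw [substHom_eq_rename] at hc
  obtain ⟨m, hm, hmF⟩ := coeff_rename_ne_zero _ _ _ hc
  exact ⟨m, h.isMonomialIdeal.mem_iff.mp hF m (mem_support_iff.mpr hmF), hm⟩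

/-- Minimal generators of a separation of `I` specialize to minimal generators of `I`. -/
theorem isMinimalGenerator_substExponent (h : IsSeparation I i J) {m : Option σ →₀ ℕ}
    (hm : IsMinimalGenerator J m) : IsMinimalGenerator I (substExponent i m) := by
  classical
  -- Minimality of `m` keeps every x^m / x_j out of `J`, so x^m occurs in no x_j F with F ∈ J.
  have key : ∀ (F : MvPolynomial (Option σ) K) (j : Option σ), F ∈ J →
      coeff m (X j * F) = 0 := by
    intro F j hF
    by_contra hc
    rw [coeff_X_mul'] at hc
    split_ifs at hc with hj
    · have hmem := h.isMonomialIdeal.mem_iff.mp hF _ (mem_support_iff.mpr hc)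
      have hle := hm.2 hmem tsub_le_self j
      have : m j ≠ 0 := Finsupp.mem_support_iff.mp hj
      simp at hle
      omega
    · exact hc rfl
  have hmI := h.substHom_mem hm.1
  rw [substHom_monomial] at hmI
  refine ⟨hmI, ?_⟩
  intro w hw hle
  by_contra hnle
  obtain ⟨d, hd⟩ := exists_add_of_le hle
  have hd0 : d ≠ 0 := by rintro rfl; simp [hd] at hnle
  obtain ⟨j, hj⟩ := Finsupp.ne_iff.mp hd0
  obtain ⟨W, hW, rfl⟩ := h.exists_monomial_lift hw
  obtain ⟨e, rfl⟩ : ∃ e, d = Finsupp.single j 1 + e :=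
    exists_add_of_le (by simpa [Finsupp.single_le_iff, Nat.one_le_iff_ne_zero] using hj)
  set F : MvPolynomial (Option σ) K := monomial (e.mapDomain some) 1 * monomial W 1
  have hFJ : F ∈ J := Ideal.mul_mem_left _ _ hW
  -- x^m and x_j F have the same specialization, so their difference lies in (y - x_i) J; comparing
  -- coefficients at `m` gives 1 = 0.
  obtain ⟨H, hH, hEq⟩ := h.exists_mul_eq (F := monomial m 1 - X (some j) * F)
    (sub_mem hm.1 (Ideal.mul_mem_left _ _ hFJ)) (by
      rw [map_sub, sub_eq_zero, map_mul, map_mul, substHom_monomial, substHom_monomial,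
        substHom_monomial, substHom_X, substExponent_mapDomain_some, hd, Option.getD_some, X,
        monomial_mul, monomial_mul, one_mul, one_mul, add_comm, add_assoc])
  have := congrArg (coeff m) hEq
  rw [sub_mul, coeff_sub, coeff_sub, key _ _ hFJ, key _ _ hH, key _ _ hH] at this
  simp at this

/-- Two lifts differ by (y - x_i) H with H ∈ J; differentiating and setting y = x_i leaves the
specialization of H, which is in I. -/
theorem mk_substHom_pderiv_congr (h : IsSeparation I i J) {F F' : MvPolynomial (Option σ) K}
    (hF : F ∈ J) (hF' : F' ∈ J) (hFF' : substHom K i F = substHom K i F') :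
    Ideal.Quotient.mk I (substHom K i (pderiv none F)) =
      Ideal.Quotient.mk I (substHom K i (pderiv none F')) := by
  classical
  obtain ⟨H, hH, hEq⟩ := h.exists_mul_eq (sub_mem hF hF') (by rw [map_sub, hFF', sub_self])
  rw [Ideal.Quotient.eq, ← map_sub, ← map_sub, hEq]
  have : substHom K i (pderiv none ((X none - X (some i)) * H)) = substHom K i H := by
    simp [Derivation.leibniz, substHom_X, pderiv_X]
  rw [this]
  exact h.substHom_mem hH

/-- The first-order deformation attached to a separation: lift `f ∈ I` to `F ∈ J`, and
specialize `∂F/∂y`. -/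
noncomputable def deformation (h : IsSeparation I i J) :
    I →ₗ[MvPolynomial σ K] MvPolynomial σ K ⧸ I where
  toFun f := Ideal.Quotient.mk I (substHom K i (pderiv none (h.exists_lift f.2).choose))
  map_add' f g := by
    obtain ⟨hf, hf'⟩ := (h.exists_lift f.2).choose_spec
    obtain ⟨hg, hg'⟩ := (h.exists_lift g.2).choose_spec
    obtain ⟨hfg, hfg'⟩ := (h.exists_lift (f + g).2).choose_spec
    rw [← map_add, ← map_add, ← map_add]
    exact h.mk_substHom_pderiv_congr hfg (add_mem hf hg)
      (by rw [hfg', map_add, hf', hg']; rfl)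
  map_smul' s f := by
    obtain ⟨hf, hf'⟩ := (h.exists_lift f.2).choose_spec
    obtain ⟨hsf, hsf'⟩ := (h.exists_lift (s • f).2).choose_spec
    rw [h.mk_substHom_pderiv_congr hsf (Ideal.mul_mem_left J (rename some s) hf)
      (by rw [hsf', map_mul, hf', substHom_rename_some]; rfl)]
    -- The Leibniz term containing ∂s/∂y carries the factor f, so it vanishes modulo I.
    rw [Derivation.leibniz]
    simp only [smul_eq_mul, map_add, map_mul, hf', substHom_rename_some, RingHom.id_apply,
      Ideal.Quotient.eq_zero_iff_mem.mpr f.2, zero_mul, add_zero]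
    rfl

theorem deformation_apply (h : IsSeparation I i J) {F : MvPolynomial (Option σ) K} (hF : F ∈ J)
    (f : I) (hf : substHom K i F = f) :
    h.deformation f = Ideal.Quotient.mk I (substHom K i (pderiv none F)) := by
  obtain ⟨hf', hf''⟩ := (h.exists_lift f.2).choose_spec
  exact h.mk_substHom_pderiv_congr hf' hF (hf''.trans hf.symm)

end IsSeparation

end MonomialIdeals

/-! ### Multidegrees, and the degree -e_i of the deformation. -/

section Multidegrees

variable {σ K : Type*} [Field K]

theorem weight_single_one_apply (m : σ →₀ ℕ) (j : σ) :
    Finsupp.weight (fun j : σ => Finsupp.single j (1 : ℤ)) m j = m j := by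
  classical
  rw [Finsupp.weight_apply, Finsupp.sum, Finsupp.finsetSum_apply]
  simp +contextual [Finsupp.single_apply, eq_comm]

theorem coe_eq_of_coeff_ne_zero {d : σ →₀ ℤ} {f : MvPolynomial σ K}
    (hf : f ∈ polyComponent K d) {m : σ →₀ ℕ} (hm : coeff m f ≠ 0) (j : σ) : (m j : ℤ) = d j := by
  have : Finsupp.weight (fun j : σ => Finsupp.single j (1 : ℤ)) m = d := hf hm
  rw [← this, weight_single_one_apply]

theorem monomial_mem_polyComponent {d : σ →₀ ℤ} {m : σ →₀ ℕ} (h : ∀ j, (m j : ℤ) = d j) (c : K) :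
    monomial m c ∈ polyComponent K d := by
  refine (mem_weightedHomogeneousSubmodule _ _ _ _).mpr (isWeightedHomogeneous_monomial _ _ _ ?_)
  ext j
  rw [weight_single_one_apply, h]

theorem eq_monomial_of_mem_polyComponent {d : σ →₀ ℤ} {f : MvPolynomial σ K}
    (hf : f ∈ polyComponent K d) {m : σ →₀ ℕ} (h : ∀ j, (m j : ℤ) = d j) :
    f = monomial m (coeff m f) := by
  classical
  ext n
  rw [coeff_monomial]
  split_ifs with hn
  · rw [hn]
  · by_contra hc
    refine hn (Finsupp.ext fun j => ?_)
    have := coe_eq_of_coeff_ne_zero hf hc j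
    have := h j
    omega

theorem eq_zero_of_mem_polyComponent {d : σ →₀ ℤ} {f : MvPolynomial σ K}
    (hf : f ∈ polyComponent K d) {j : σ} (h : d j < 0) : f = 0 := by
  ext n
  by_contra hc
  have := coe_eq_of_coeff_ne_zero hf hc j
  omega

theorem IsSeparation.deformation_mem_homComponent {I : Ideal (MvPolynomial σ K)} {i : σ}
    {J : Ideal (MvPolynomial (Option σ) K)} (h : IsSeparation I i J) (hI : IsMonomialIdeal I) :
    h.deformation ∈ homComponent I (-Finsupp.single i (1 : ℤ)) := by
  classical
  intro d f hf
  by_cases hf0 : (f : MvPolynomial σ K) = 0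
  · have : f = 0 := Subtype.ext hf0
    rw [this, map_zero]
    exact zero_mem _
  obtain ⟨m, hm⟩ := MvPolynomial.ne_zero_iff.mp hf0
  have hd := coe_eq_of_coeff_ne_zero hf hm
  have hfm := eq_monomial_of_mem_polyComponent hf hd
  -- A homogeneous f is a multiple of one monomial and lifts to a multiple of one monomial of `J`;
  -- ∂/∂y removes one y, which specializes to x_i.
  obtain ⟨W, hW, rfl⟩ := h.exists_monomial_lift (hI.mem_iff.mp f.2 m (mem_support_iff.mpr hm))
  set c := coeff (substExponent i W) (f : MvPolynomial σ K)
  have hcW : monomial W c ∈ J := by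
    have := Ideal.mul_mem_left J (C c) hW
    rwa [C_mul_monomial, mul_one] at this
  rw [h.deformation_apply hcW f (by rw [substHom_monomial, ← hfm]), pderiv_monomial]
  by_cases hW0 : W none = 0
  · simp [hW0]
  rw [substHom_monomial]
  refine ⟨_, monomial_mem_polyComponent (fun j => ?_) _, rfl⟩
  have hle : Finsupp.single none 1 ≤ W := by
    simpa [Finsupp.single_le_iff, Nat.one_le_iff_ne_zero] using hW0
  obtain ⟨W', rfl⟩ := exists_add_of_le hle
  rw [add_tsub_cancel_left, Finsupp.add_apply, ← hd, substExponent_add, substExponent_single]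
  simp only [Finsupp.add_apply, Finsupp.neg_apply, Option.getD_none, Finsupp.single_apply]
  split_ifs <;> push_cast <;> ring

end Multidegrees

/-! ### Monomials and minimal generators of edge ideals. -/

section EdgeIdeals

variable {V : Type*} {K : Type*} [Field K]

theorem edgeIdeal_eq_span_monomial (G : SimpleGraph V) :
    edgeIdeal K G = Ideal.span ((fun a => monomial a (1 : K)) ''
      {a | ∃ i j, G.Adj i j ∧ a = Finsupp.single i 1 + Finsupp.single j 1}) := by
  rw [edgeIdeal]
  congr 1
  ext f
  constructor
  · rintro ⟨i, j, hij, rfl⟩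
    exact ⟨_, ⟨i, j, hij, rfl⟩, by simp [X, monomial_mul]⟩
  · rintro ⟨_, ⟨i, j, hij, rfl⟩, rfl⟩
    exact ⟨i, j, hij, by simp [X, monomial_mul]⟩

theorem isMonomialIdeal_edgeIdeal (G : SimpleGraph V) : IsMonomialIdeal (edgeIdeal K G) :=
  ⟨_, edgeIdeal_eq_span_monomial G⟩

theorem single_add_single_le_iff {u v : V} (h : u ≠ v) {m : V →₀ ℕ} :
    Finsupp.single u 1 + Finsupp.single v 1 ≤ m ↔ m u ≠ 0 ∧ m v ≠ 0 := by
  classical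
  constructor
  · intro hle
    have hu := hle u
    have hv := hle v
    simp [h, h.symm] at hu hv
    omega
  · rintro ⟨hu, hv⟩ j
    simp only [Finsupp.add_apply, Finsupp.single_apply]
    split_ifs with h1 h2 h2
    · exact absurd (h1.trans h2.symm) h
    · subst h1; omega
    · subst h2; omega
    · omega

theorem monomial_mem_edgeIdeal {G : SimpleGraph V} {m : V →₀ ℕ} :
    monomial m (1 : K) ∈ edgeIdeal K G ↔ ∃ u v, G.Adj u v ∧ m u ≠ 0 ∧ m v ≠ 0 := by
  classical
  rw [edgeIdeal_eq_span_monomial, mem_ideal_span_monomial_image]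
  simp only [support_monomial, one_ne_zero, if_false, Finset.mem_singleton, forall_eq]
  constructor
  · rintro ⟨_, ⟨u, v, huv, rfl⟩, hle⟩
    exact ⟨u, v, huv, (single_add_single_le_iff huv.ne).mp hle⟩
  · rintro ⟨u, v, huv, hm⟩
    exact ⟨_, ⟨u, v, huv, rfl⟩, (single_add_single_le_iff huv.ne).mpr hm⟩

theorem X_mul_X_mem_edgeIdeal {G : SimpleGraph V} {u v : V} (h : G.Adj u v) :
    (X u * X v : MvPolynomial V K) ∈ edgeIdeal K G :=
  Ideal.subset_span ⟨u, v, h, rfl⟩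

theorem isMinimalGenerator_edgeIdeal_iff {G : SimpleGraph V} {m : V →₀ ℕ} :
    IsMinimalGenerator (edgeIdeal K G) m ↔
      ∃ u v, G.Adj u v ∧ m = Finsupp.single u 1 + Finsupp.single v 1 := by
  constructor
  · intro h
    obtain ⟨u, v, huv, hm⟩ := monomial_mem_edgeIdeal.mp h.1
    refine ⟨u, v, huv, ?_⟩
    have hle := (single_add_single_le_iff huv.ne).mpr hm
    refine le_antisymm (h.2 ?_ hle) hle
    exact monomial_mem_edgeIdeal.mpr ⟨u, v, huv, by simp, by simp⟩
  · rintro ⟨u, v, huv, rfl⟩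
    refine ⟨monomial_mem_edgeIdeal.mpr ⟨u, v, huv, by simp, by simp⟩, ?_⟩
    intro b hb hle
    obtain ⟨p, q, hpq, hp, hq⟩ := monomial_mem_edgeIdeal.mp hb
    classical
    have aux : ∀ x, b x ≠ 0 → x = u ∨ x = v := by
      intro x hx
      have := hle x
      simp only [Finsupp.add_apply, Finsupp.single_apply] at this
      split_ifs at this <;> simp_all
    rw [single_add_single_le_iff huv.ne]
    rcases aux p hp with rfl | rfl <;> rcases aux q hq with rfl | rfl
    · exact absurd rfl hpq.ne
    · exact ⟨hp, hq⟩
    · exact ⟨hq, hp⟩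
    · exact absurd rfl hpq.ne

theorem coeff_single_eq_zero_of_mem_edgeIdeal {G : SimpleGraph V} {f : MvPolynomial V K}
    (hf : f ∈ edgeIdeal K G) (v : V) : coeff (Finsupp.single v 1) f = 0 := by
  classical
  by_contra hc
  have := (isMonomialIdeal_edgeIdeal G).mem_iff.mp hf _ (mem_support_iff.mpr hc)
  obtain ⟨p, q, hpq, hp, hq⟩ := monomial_mem_edgeIdeal.mp this
  simp only [Finsupp.single_apply, ne_eq, ite_eq_right_iff, one_ne_zero, imp_false,
    not_not] at hp hq
  exact hpq.ne (hp.symm.trans hq)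

end EdgeIdeals

/-! ### Vanishing of T¹ implies inseparability. -/

section CotangentToInseparable

variable {V : Type*} {K : Type*} [Field K]

theorem T1Component_eq_bot_iff {I : Ideal (MvPolynomial V K)} {c : V →₀ ℤ} :
    T1Component I c = ⊥ ↔ ∀ φ ∈ homComponent I c, ∃ D, deltaStar I D = φ := by
  rw [T1Component, Submodule.eq_bot_iff]
  have key : ∀ φ, (LinearMap.range (deltaStar I)).mkQ φ = 0 ↔ ∃ D, deltaStar I D = φ := by
    intro φ
    rw [Submodule.mkQ_apply, Submodule.Quotient.mk_eq_zero]
    rfl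
  constructor
  · exact fun h φ hφ => (key φ).mp (h _ ⟨φ, hφ, rfl⟩)
  · rintro h _ ⟨φ, hφ, rfl⟩
    exact (key φ).mpr (h φ hφ)

/-- `hpi` covers p = x_i and p = y at once. Without p, `m` specializes to some x_w with w ≠ i, whose
only monomial preimage is x_w. -/
theorem IsSeparation.exists_edge {G : SimpleGraph V} {i : V}
    {J : Ideal (MvPolynomial (Option V) K)} (h : IsSeparation (edgeIdeal K G) i J)
    {m : Option V →₀ ℕ} (hm : IsMinimalGenerator J m) {p : Option V} (hp : m p ≠ 0)
    (hpi : p.getD i = i) :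
    ∃ v, G.Adj i v ∧ m = Finsupp.single p 1 + Finsupp.single (some v) 1 := by
  classical
  obtain ⟨u, v, huv, he⟩ :=
    isMinimalGenerator_edgeIdeal_iff.mp (h.isMinimalGenerator_substExponent hm)
  obtain ⟨m', rfl⟩ : ∃ m', m = Finsupp.single p 1 + m' :=
    exists_add_of_le (by simpa [Finsupp.single_le_iff, Nat.one_le_iff_ne_zero] using hp)
  rw [substExponent_add, substExponent_single, hpi] at he
  obtain ⟨w, hw, he'⟩ : ∃ w, G.Adj i w ∧ substExponent i m' = Finsupp.single w 1 := by
    have hi := DFunLike.congr_fun he i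
    simp only [Finsupp.add_apply, Finsupp.single_apply, if_true] at hi
    by_cases hu : u = i
    · subst hu
      exact ⟨v, huv, add_left_cancel he⟩
    · by_cases hv : v = i
      · subst hv
        exact ⟨u, huv.symm, add_left_cancel (he.trans (add_comm _ _))⟩
      · simp [hu, hv] at hi
  refine ⟨w, hw, congrArg _ ?_⟩
  have hm' : m' ≠ 0 := by
    rintro rfl
    have := DFunLike.congr_fun he' w
    simp [substExponent] at this
  obtain ⟨q, hq⟩ := Finsupp.ne_iff.mp hm'
  obtain ⟨m'', rfl⟩ : ∃ m'', m' = Finsupp.single q 1 + m'' :=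
    exists_add_of_le (by simpa [Finsupp.single_le_iff, Nat.one_le_iff_ne_zero] using hq)
  rw [substExponent_add, substExponent_single] at he'
  have hqw : q.getD i = w := by
    by_contra hne
    have := DFunLike.congr_fun he' (q.getD i)
    simp [Ne.symm hne] at this
  have hqs : q = some w := by
    cases q with
    | none => exact absurd hqw hw.ne
    | some q => exact congrArg some hqw
  subst hqs
  have h0 : substExponent i m'' = 0 := by
    simpa using he'
  have hm'' : m'' = 0 := by
    ext x
    by_contra hx
    obtain ⟨n, rfl⟩ : ∃ n, m'' = Finsupp.single x 1 + n :=
      exists_add_of_le (by simpa [Finsupp.single_le_iff, Nat.one_le_iff_ne_zero] using hx)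
    have := DFunLike.congr_fun h0 (x.getD i)
    simp [substExponent_add, substExponent_single] at this
  rw [hm'', add_zero]

/-- In x_i D(x_v) + x_v D(x_i) the first summand has only multiples of x_i. -/
theorem coeff_single_derivation_X_mul_X (D : Derivation K (MvPolynomial V K) (MvPolynomial V K))
    {i v : V} (h : i ≠ v) :
    coeff (Finsupp.single v 1) (D (X i * X v)) = coeff 0 (D (X i)) := by
  classical
  rw [Derivation.leibniz, smul_eq_mul, smul_eq_mul, coeff_add, coeff_X_mul', coeff_X_mul']
  simp [h]

theorem isInseparableGraph_of_T1Component_eq_bot {G : SimpleGraph V}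
    (hT : ∀ i : V, T1Component (edgeIdeal K G) (-Finsupp.single i (1 : ℤ)) = ⊥) :
    IsInseparableGraph K G := by
  classical
  rintro ⟨i, J, h⟩
  obtain ⟨D, hD⟩ := T1Component_eq_bot_iff.mp (hT i) _
    (h.deformation_mem_homComponent (isMonomialIdeal_edgeIdeal G))
  -- Through the lift p x_v the deformation takes x_i x_v to x_v if p = y and to 0 if p = x_i. This
  -- agrees with D(x_i x_v) modulo an ideal without linear terms.
  have key : ∀ (p : Option V) (v : V), G.Adj i v → p.getD i = i →
      (monomial (Finsupp.single p 1 + Finsupp.single (some v) 1) (1 : K)) ∈ J →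
      coeff 0 (D (X i)) = if p = none then 1 else 0 := by
    intro p v hv hp hJ
    have hX : monomial (Finsupp.single p 1 + Finsupp.single (some v) 1) (1 : K) =
        X p * X (some v) := by simp [X, monomial_mul]
    rw [hX] at hJ
    have h1 := h.deformation_apply hJ ⟨X i * X v, X_mul_X_mem_edgeIdeal hv⟩
      (by simp [substHom_X, hp])
    rw [← hD] at h1
    have h2 := coeff_single_eq_zero_of_mem_edgeIdeal (Ideal.Quotient.eq.mp h1) v
    rw [coeff_sub, sub_eq_zero] at h2
    rw [← coeff_single_derivation_X_mul_X D hv.ne]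
    refine h2.trans ?_
    rw [Derivation.leibniz]
    by_cases hn : p = none
    · simp [pderiv_X, substHom_X, hn]
    · simp [pderiv_X, hn]
  obtain ⟨a, ha, ha'⟩ := h.dvd_x
  obtain ⟨b, hb, hb'⟩ := h.dvd_y
  obtain ⟨u, hu, rfl⟩ := h.exists_edge ha ha' rfl
  obtain ⟨v, hv, rfl⟩ := h.exists_edge hb hb' rfl
  have h1 := key _ _ hu rfl ha.1
  have h2 := key _ _ hv rfl hb.1
  rw [h1] at h2
  simp at h2

end CotangentToInseparable

/-! ### Connectedness of G^(i) implies vanishing of T¹. -/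

section ConnectedToCotangent

variable {V : Type*} {K : Type*} [Field K]

theorem coeff_single_add_single_eq_zero {G : SimpleGraph V} {f : MvPolynomial V K}
    (hf : f ∈ edgeIdeal K G) {k l : V} (h : ¬ G.Adj k l) :
    coeff (Finsupp.single k 1 + Finsupp.single l 1) f = 0 := by
  classical
  by_contra hc
  have hmem := (isMonomialIdeal_edgeIdeal G).mem_iff.mp hf _ (mem_support_iff.mpr hc)
  obtain ⟨p, q, hpq, hp, hq⟩ := monomial_mem_edgeIdeal.mp hmem
  have aux : ∀ x, (Finsupp.single k 1 + Finsupp.single l 1 : V →₀ ℕ) x ≠ 0 → x = k ∨ x = l := by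
    intro x hx
    simp only [Finsupp.add_apply, Finsupp.single_apply] at hx
    split_ifs at hx <;> simp_all
  rcases aux p hp with rfl | rfl <;> rcases aux q hq with rfl | rfl
  · exact hpq.ne rfl
  · exact h hpq
  · exact h hpq.symm
  · exact hpq.ne rfl

theorem edgeIdeal_hom_ext {G : SimpleGraph V} {M : Type*} [AddCommGroup M]
    [Module (MvPolynomial V K) M] {φ ψ : edgeIdeal K G →ₗ[MvPolynomial V K] M}
    (h : ∀ u v (huv : G.Adj u v),
      φ ⟨X u * X v, X_mul_X_mem_edgeIdeal huv⟩ = ψ ⟨X u * X v, X_mul_X_mem_edgeIdeal huv⟩) :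
    φ = ψ := by
  refine LinearMap.ext fun f => ?_
  obtain ⟨f, hf⟩ := f
  induction hf using Submodule.span_induction with
  | mem f hf =>
    obtain ⟨u, v, huv, rfl⟩ := hf
    exact h u v huv
  | zero => exact (map_zero φ).trans (map_zero ψ).symm
  | add f g hf hg ihf ihg =>
    exact (map_add φ ⟨f, hf⟩ ⟨g, hg⟩).trans
      ((congrArg₂ _ ihf ihg).trans (map_add ψ ⟨f, hf⟩ ⟨g, hg⟩).symm)
  | smul s f hf ih =>
    have hsf : (⟨s • f, Submodule.smul_mem _ s hf⟩ : edgeIdeal K G) =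
      s • (⟨f, hf⟩ : edgeIdeal K G) := rfl
    rw [hsf, LinearMap.map_smul, LinearMap.map_smul]
    exact congrArg (s • ·) ih

theorem X_mul_X_mem_polyComponent (u v : V) : (X u * X v : MvPolynomial V K) ∈
    polyComponent K (Finsupp.single u 1 + Finsupp.single v 1) := by
  classical
  rw [X, X, monomial_mul]
  apply monomial_mem_polyComponent
  intro j
  simp only [Finsupp.add_apply, Finsupp.single_apply]
  split_ifs <;> simp

theorem exists_apply_X_mul_X_eq {G : SimpleGraph V} {i : V}
    {φ : edgeIdeal K G →ₗ[MvPolynomial V K] MvPolynomial V K ⧸ edgeIdeal K G}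
    (hφ : φ ∈ homComponent (edgeIdeal K G) (-Finsupp.single i (1 : ℤ))) {k : V}
    (hk : G.Adj i k) : ∃ c : K,
      φ ⟨X i * X k, X_mul_X_mem_edgeIdeal hk⟩ = Ideal.Quotient.mk _ (C c * X k) := by
  classical
  obtain ⟨f, hf, hfφ⟩ :=
    hφ _ ⟨X i * X k, X_mul_X_mem_edgeIdeal hk⟩ (X_mul_X_mem_polyComponent i k)
  have := eq_monomial_of_mem_polyComponent hf (m := Finsupp.single k 1) (fun j => by
    simp only [Finsupp.add_apply, Finsupp.neg_apply, Finsupp.single_apply]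
    split_ifs <;> simp)
  refine ⟨coeff (Finsupp.single k 1) f, ?_⟩
  rw [C_mul_X_eq_monomial, ← this]
  exact hfφ.symm

/-- Both x_l φ(x_i x_k) and x_k φ(x_i x_l) equal φ(x_i x_k x_l), so (c - d) x_k x_l lies in the edge
ideal, where x_k x_l cannot occur. -/
theorem eq_of_not_adj {G : SimpleGraph V} {i : V}
    {φ : edgeIdeal K G →ₗ[MvPolynomial V K] MvPolynomial V K ⧸ edgeIdeal K G} {k l : V}
    (hk : G.Adj i k) (hl : G.Adj i l) (h : ¬ G.Adj k l) {c d : K}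
    (hc : φ ⟨X i * X k, X_mul_X_mem_edgeIdeal hk⟩ = Ideal.Quotient.mk _ (C c * X k))
    (hd : φ ⟨X i * X l, X_mul_X_mem_edgeIdeal hl⟩ = Ideal.Quotient.mk _ (C d * X l)) :
    c = d := by
  classical
  have h1 : (X l : MvPolynomial V K) • φ ⟨X i * X k, X_mul_X_mem_edgeIdeal hk⟩ =
      (X k : MvPolynomial V K) • φ ⟨X i * X l, X_mul_X_mem_edgeIdeal hl⟩ := by
    rw [← map_smul, ← map_smul]
    congr 1
    apply Subtype.ext
    change X l * (X i * X k) = X k * (X i * X l)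
    ring
  rw [hc, hd] at h1
  have h2 : Ideal.Quotient.mk (edgeIdeal K G) (X l * (C c * X k)) =
    Ideal.Quotient.mk (edgeIdeal K G) (X k * (C d * X l)) := h1
  rw [Ideal.Quotient.eq] at h2
  have h3 : X l * (C c * X k) - X k * (C d * X l) =
      monomial (Finsupp.single k 1 + Finsupp.single l 1) (c - d) := by
    have : monomial (Finsupp.single k 1 + Finsupp.single l 1) (c - d) =
        C (c - d) * (X k * X l) := by
      rw [X, X, monomial_mul, C_mul_monomial, mul_one, mul_one]
    rw [this, C_sub]
    ring
  have h4 := coeff_single_add_single_eq_zero h2 h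
  rw [h3, coeff_monomial, if_pos rfl] at h4
  exact sub_eq_zero.mp h4

theorem apply_X_mul_X_eq_zero {G : SimpleGraph V} {i : V}
    {φ : edgeIdeal K G →ₗ[MvPolynomial V K] MvPolynomial V K ⧸ edgeIdeal K G}
    (hφ : φ ∈ homComponent (edgeIdeal K G) (-Finsupp.single i (1 : ℤ))) {u v : V}
    (huv : G.Adj u v) (hu : u ≠ i) (hv : v ≠ i) :
    φ ⟨X u * X v, X_mul_X_mem_edgeIdeal huv⟩ = 0 := by
  obtain ⟨g, hg, hgφ⟩ :=
    hφ _ ⟨X u * X v, X_mul_X_mem_edgeIdeal huv⟩ (X_mul_X_mem_polyComponent u v)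
  rw [← hgφ, eq_zero_of_mem_polyComponent hg (j := i) (by simp [hu, hv]), map_zero]

/-- `Nonempty α` supplies the constant when `W` is empty, as happens for an isolated vertex i. -/
theorem SimpleGraph.Preconnected.exists_forall_eq {W : Type*} {G : SimpleGraph W}
    (hG : G.Preconnected) {α : Type*} [Nonempty α] {f : W → α}
    (hf : ∀ k l, G.Adj k l → f k = f l) : ∃ c, ∀ k, f k = c := by
  by_cases hne : Nonempty W
  · obtain ⟨k₀⟩ := hne
    refine ⟨f k₀, fun k => ?_⟩
    obtain ⟨w⟩ := hG k k₀
    induction w with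
    | nil => rfl
    | cons hkl _ ih => exact (hf _ _ hkl).trans ih
  · exact ⟨Classical.arbitrary α, fun k => absurd ⟨k⟩ hne⟩

theorem T1Component_eq_bot_of_preconnected {G : SimpleGraph V} {i : V}
    (hG : (neighborCompl G i).Preconnected) :
    T1Component (edgeIdeal K G) (-Finsupp.single i (1 : ℤ)) = ⊥ := by
  rw [T1Component_eq_bot_iff]
  intro φ hφ
  choose lam hlam using fun k : G.neighborSet i => exists_apply_X_mul_X_eq hφ k.2
  obtain ⟨c, hc⟩ := hG.exists_forall_eq (f := lam) (fun k l hkl =>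
    eq_of_not_adj k.2 l.2 (by simpa using ((SimpleGraph.compl_adj _ _ _).mp hkl).2)
      (hlam k) (hlam l))
  refine ⟨(C c : MvPolynomial V K) • pderiv i, edgeIdeal_hom_ext ?_⟩
  have hedge : ∀ k (hk : G.Adj i k), deltaStar (edgeIdeal K G) ((C c : MvPolynomial V K) • pderiv i)
      ⟨X i * X k, X_mul_X_mem_edgeIdeal hk⟩ = φ ⟨X i * X k, X_mul_X_mem_edgeIdeal hk⟩ := by
    intro k hk
    rw [hlam ⟨k, hk⟩, hc]
    change Ideal.Quotient.mk _ (((C c : MvPolynomial V K) • pderiv i) (X i * X k)) = _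
    rw [Derivation.smul_apply, Derivation.leibniz, pderiv_X_self, pderiv_X_of_ne hk.ne',
      smul_zero, zero_add, smul_eq_mul, smul_eq_mul, mul_one]
  intro u v huv
  by_cases hu : u = i
  · subst hu
    exact hedge v huv
  by_cases hv : v = i
  · subst hv
    simp only [mul_comm (X u : MvPolynomial V K) (X v)]
    exact hedge u huv.symm
  refine Eq.trans ?_ (apply_X_mul_X_eq_zero hφ huv hu hv).symm
  change Ideal.Quotient.mk _ (((C c : MvPolynomial V K) • pderiv i) (X u * X v)) = _
  rw [Derivation.smul_apply, Derivation.leibniz, pderiv_X_of_ne hu, pderiv_X_of_ne hv,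
    smul_zero, smul_zero, add_zero, smul_zero, map_zero]

end ConnectedToCotangent

/-! ### A disconnected G^(i) gives a separation by vertex splitting. -/

section InseparableToConnected

variable {V : Type*} {K : Type*} [Field K]

/-- The graph obtained from `G` by splitting the vertex `i` into `some i`, which keeps the
neighbours in `A`, and a new vertex `none`, which keeps the neighbours outside `A`. -/
def splitGraph (G : SimpleGraph V) (i : V) (A : Set V) : SimpleGraph (Option V) where
  Adj u v := G.Adj (u.getD i) (v.getD i) ∧ (u = some i → v.getD i ∈ A) ∧
    (v = some i → u.getD i ∈ A) ∧ (u = none → v.getD i ∉ A) ∧ (v = none → u.getD i ∉ A)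
  symm := ⟨fun _ _ ⟨h, h1, h2, h3, h4⟩ => ⟨h.symm, h2, h1, h4, h3⟩⟩
  loopless := ⟨fun _ h => h.1.ne rfl⟩

theorem splitGraph_adj_some {G : SimpleGraph V} {i : V} {A : Set V} {v : V} (h : G.Adj i v)
    (hv : v ∈ A) : (splitGraph G i A).Adj (some i) (some v) :=
  ⟨h, fun _ => hv, fun hvi => absurd (Option.some.inj hvi) h.ne',
    fun h => absurd h (by simp), fun h => absurd h (by simp)⟩

theorem splitGraph_adj_none {G : SimpleGraph V} {i : V} {A : Set V} {v : V} (h : G.Adj i v)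
    (hv : v ∉ A) : (splitGraph G i A).Adj none (some v) :=
  ⟨h, fun h => absurd h (by simp), fun hvi => absurd (Option.some.inj hvi) h.ne',
    fun _ => hv, fun h => absurd h (by simp)⟩

theorem map_substHom_edgeIdeal_splitGraph (G : SimpleGraph V) (i : V) (A : Set V) :
    Ideal.map (substHom K i) (edgeIdeal K (splitGraph G i A)) = edgeIdeal K G := by
  apply le_antisymm
  · rw [edgeIdeal, Ideal.map_span, Ideal.span_le]
    rintro _ ⟨_, ⟨u, v, huv, rfl⟩, rfl⟩
    rw [SetLike.mem_coe, map_mul, substHom_X, substHom_X]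
    exact X_mul_X_mem_edgeIdeal huv.1
  · have lift : ∀ u v, (splitGraph G i A).Adj u v → (X (u.getD i) * X (v.getD i) :
        MvPolynomial V K) ∈ Ideal.map (substHom K i) (edgeIdeal K (splitGraph G i A)) := by
      intro u v huv
      rw [← substHom_X, ← substHom_X, ← map_mul]
      exact Ideal.mem_map_of_mem _ (X_mul_X_mem_edgeIdeal huv)
    have hi : ∀ v, G.Adj i v → (X i * X v : MvPolynomial V K) ∈
        Ideal.map (substHom K i) (edgeIdeal K (splitGraph G i A)) := by
      intro v hv
      by_cases hA : v ∈ A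
      · have := lift _ _ (splitGraph_adj_some hv hA)
        rwa [Option.getD_some, Option.getD_some] at this
      · have := lift _ _ (splitGraph_adj_none hv hA)
        rwa [Option.getD_none, Option.getD_some] at this
    conv_lhs => rw [edgeIdeal]
    rw [Ideal.span_le]
    rintro _ ⟨u, v, huv, rfl⟩
    rw [SetLike.mem_coe]
    by_cases hu : u = i
    · exact hu ▸ hi v (hu ▸ huv)
    by_cases hv : v = i
    · rw [mul_comm]
      exact hv ▸ hi u (hv ▸ huv.symm)
    exact lift (some u) (some v) ⟨huv, fun h => absurd (Option.some.inj h) hu,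
      fun h => absurd (Option.some.inj h) hv, fun h => absurd h (by simp),
      fun h => absurd h (by simp)⟩

/-- Setting the variables outside `W` to zero. -/
noncomputable def killOutside (K : Type*) [Field K] {σ : Type*} (W : Set σ) :
    MvPolynomial σ K →ₐ[K] MvPolynomial σ K :=
  open Classical in aeval fun j => if j ∈ W then X j else 0

theorem killOutside_X_of_mem {σ : Type*} {W : Set σ} {j : σ} (h : j ∈ W) :
    killOutside K W (X j) = X j := by
  simp [killOutside, h]

theorem killOutside_X_of_notMem {σ : Type*} {W : Set σ} {j : σ} (h : j ∉ W) :
    killOutside K W (X j) = 0 := by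
  simp [killOutside, h]

theorem killOutside_monomial_of_subset {σ : Type*} {W : Set σ} {m : σ →₀ ℕ}
    (h : ∀ j, m j ≠ 0 → j ∈ W) (c : K) : killOutside K W (monomial m c) = monomial m c := by
  rw [monomial_eq, map_mul, Finsupp.prod, map_prod]
  congr 1
  · exact (killOutside K W).commutes c
  · refine Finset.prod_congr rfl fun j hj => ?_
    rw [map_pow, killOutside_X_of_mem (h j (Finsupp.mem_support_iff.mp hj))]

theorem killOutside_monomial_of_not_subset {σ : Type*} {W : Set σ} {m : σ →₀ ℕ} {j : σ}
    (hj : m j ≠ 0) (h : j ∉ W) (c : K) : killOutside K W (monomial m c) = 0 := by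
  rw [monomial_eq, map_mul, Finsupp.prod, map_prod]
  rw [Finset.prod_eq_zero (Finsupp.mem_support_iff.mpr hj), mul_zero]
  rw [map_pow, killOutside_X_of_notMem h, zero_pow hj]

theorem coeff_killOutside {σ : Type*} {W : Set σ} {m : σ →₀ ℕ} (h : ∀ j, m j ≠ 0 → j ∈ W)
    (f : MvPolynomial σ K) : coeff m (killOutside K W f) = coeff m f := by
  classical
  induction f using MvPolynomial.induction_on' with
  | monomial n c =>
    by_cases hn : ∀ j, n j ≠ 0 → j ∈ W
    · rw [killOutside_monomial_of_subset hn]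
    · push Not at hn
      obtain ⟨j, hj, hjW⟩ := hn
      rw [killOutside_monomial_of_not_subset hj hjW, coeff_zero, coeff_monomial, if_neg]
      rintro rfl
      exact hjW (h j hj)
  | add p q hp hq => rw [map_add, coeff_add, coeff_add, hp, hq]

theorem killOutside_eq_zero {σ : Type*} {G : SimpleGraph σ} {W : Set σ}
    (hW : ∀ u ∈ W, ∀ v ∈ W, ¬ G.Adj u v) {f : MvPolynomial σ K} (hf : f ∈ edgeIdeal K G) :
    killOutside K W f = 0 := by
  have : edgeIdeal K G ≤ RingHom.ker (killOutside K W).toRingHom := by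
    rw [edgeIdeal, Ideal.span_le]
    rintro _ ⟨u, v, huv, rfl⟩
    refine (RingHom.mem_ker).mpr ((map_mul (killOutside K W) _ _).trans ?_)
    by_cases hu : u ∈ W
    · rw [killOutside_X_of_notMem (j := v) fun hv => hW u hu v hv huv, mul_zero]
    · rw [killOutside_X_of_notMem hu, zero_mul]
  exact this hf

/-- If every neighbour of `p` is adjacent to every neighbour of `q`, then `x_p - x_q` is a
non-zero-divisor modulo the edge ideal. -/
theorem mk_X_sub_X_mem_nonZeroDivisors {σ : Type*} {G : SimpleGraph σ} {p q : σ} (hpq : p ≠ q)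
    (h : ∀ a b, G.Adj p a → G.Adj q b → G.Adj a b) :
    Ideal.Quotient.mk (edgeIdeal K G) (X p - X q) ∈
      nonZeroDivisors (MvPolynomial σ K ⧸ edgeIdeal K G) := by
  classical
  rw [mem_nonZeroDivisors_iff_right]
  intro g hg
  obtain ⟨f, rfl⟩ := Ideal.Quotient.mk_surjective g
  rw [← map_mul, Ideal.Quotient.eq_zero_iff_mem] at hg
  rw [Ideal.Quotient.eq_zero_iff_mem, (isMonomialIdeal_edgeIdeal G).mem_iff]
  intro m hm
  by_contra hmem
  rw [monomial_mem_edgeIdeal] at hmem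
  push Not at hmem
  -- The support of `m` is independent, and stays so after adding an r with no neighbour in it.
  have hW : ∀ r, (∀ a, G.Adj r a → m a = 0) →
      ∀ u ∈ {j | m j ≠ 0 ∨ j = r}, ∀ v ∈ {j | m j ≠ 0 ∨ j = r}, ¬ G.Adj u v := by
    rintro r hr u (hu | rfl) v (hv | rfl) huv
    · exact hv (hmem u v huv hu)
    · exact hu (hr u huv.symm)
    · exact hv (hr v huv)
    · exact huv.ne rfl
  -- Otherwise p and q have neighbours a and b in the support of `m`, and `h` makes ab an edge
  -- there.
  obtain ⟨r, hr, hr'⟩ : ∃ r, (r = p ∨ r = q) ∧ ∀ a, G.Adj r a → m a = 0 := by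
    by_contra hcon
    push Not at hcon
    obtain ⟨a, ha, hma⟩ := hcon p (Or.inl rfl)
    obtain ⟨b, hb, hmb⟩ := hcon q (Or.inr rfl)
    exact hmb (hmem a b (h a b ha hb) hma)
  -- Killing the variables off this independent set annihilates the ideal and leaves an equation in
  -- a domain. The coefficient of f at `m` and that of x_p - x_q at x_r survive, so neither factor
  -- is zero.
  have h0 := killOutside_eq_zero (hW r hr') hg
  rw [map_mul, mul_eq_zero] at h0
  rcases h0 with h0 | h0
  · have := congrArg (coeff m) h0
    rw [coeff_killOutside (W := {j | m j ≠ 0 ∨ j = r}) (fun j hj => Or.inl hj), coeff_zero] at this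
    exact mem_support_iff.mp hm this
  · have := congrArg (coeff (Finsupp.single r 1)) h0
    rw [coeff_killOutside (W := {j | m j ≠ 0 ∨ j = r}) (fun j hj => Or.inr (by
      by_contra hne
      exact hj (Finsupp.single_eq_of_ne hne))), coeff_zero, coeff_sub, coeff_X, coeff_X] at this
    rcases hr with rfl | rfl
    · simp [Finsupp.single_left_inj, hpq.symm] at this
    · simp [Finsupp.single_left_inj, hpq] at this

theorem isSeparation_edgeIdeal_splitGraph {G : SimpleGraph V} {i : V} {A : Set V} {u v : V}
    (hu : G.Adj i u) (huA : u ∈ A) (hv : G.Adj i v) (hvA : v ∉ A)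
    (h : ∀ a ∈ A, ∀ b ∉ A, G.Adj i a → G.Adj i b → G.Adj a b) :
    IsSeparation (edgeIdeal K G) i (edgeIdeal K (splitGraph G i A)) where
  isMonomialIdeal := isMonomialIdeal_edgeIdeal _
  map_eq := map_substHom_edgeIdeal_splitGraph G i A
  dvd_x := ⟨_, isMinimalGenerator_edgeIdeal_iff.mpr ⟨_, _, splitGraph_adj_some hu huA, rfl⟩,
    by simp⟩
  dvd_y := ⟨_, isMinimalGenerator_edgeIdeal_iff.mpr ⟨_, _, splitGraph_adj_none hv hvA, rfl⟩,
    by simp⟩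
  nonZeroDivisor := by
    refine mk_X_sub_X_mem_nonZeroDivisors (by simp) ?_
    -- The two copies of i are not adjacent to each other or to themselves, since G has no loops.
    rintro (_ | b) (_ | a) hb ha
    · exact absurd rfl hb.1.ne
    · exact absurd rfl hb.1.ne
    · exact absurd rfl ha.1.ne
    · have hbA : b ∉ A := hb.2.2.2.1 rfl
      have haA : a ∈ A := ha.2.1 rfl
      have hib : G.Adj i b := hb.1
      have hia : G.Adj i a := ha.1
      exact ⟨(h a haA b hbA hia hib).symm, fun h => absurd (Option.some.inj h) hib.ne',
        fun h => absurd (Option.some.inj h) hia.ne', fun h => absurd h (by simp),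
        fun h => absurd h (by simp)⟩

theorem preconnected_of_isInseparableGraph {G : SimpleGraph V} (hG : IsInseparableGraph K G)
    (i : V) : (neighborCompl G i).Preconnected := by
  by_contra hc
  rw [SimpleGraph.Preconnected] at hc
  push Not at hc
  obtain ⟨u, v, huv⟩ := hc
  -- `A` is the component of u. A neighbour of i in `A` and one outside it are not adjacent in
  -- G^(i), hence adjacent in G.
  refine hG ⟨i, _, isSeparation_edgeIdeal_splitGraph
    (A := {w | ∃ hw : w ∈ G.neighborSet i, (neighborCompl G i).Reachable u ⟨w, hw⟩})
    u.2 ⟨u.2, SimpleGraph.Reachable.refl _⟩ v.2 (fun ⟨_, h⟩ => huv h) ?_⟩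
  rintro a ⟨ha, hua⟩ b hb - hib
  by_contra hab
  refine hb ⟨hib, hua.trans (SimpleGraph.Adj.reachable ?_)⟩
  refine (SimpleGraph.compl_adj _ _ _).mpr ⟨?_, by simpa using hab⟩
  rintro h
  obtain rfl : a = b := congrArg Subtype.val h
  exact hb ⟨ha, hua⟩

end InseparableToConnected

theorem mainTheorem7 {V : Type*} [Finite V] (K : Type*) [Field K] (G : SimpleGraph V) :
    List.TFAE [
      IsInseparableGraph K G,
      ∀ i : V, (neighborCompl G i).Preconnected,
      ∀ i : V, T1Component (edgeIdeal K G) (-Finsupp.single i (1 : ℤ)) = ⊥] := by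
  tfae_have 1 → 2 := preconnected_of_isInseparableGraph
  tfae_have 2 → 3 := fun h i => T1Component_eq_bot_of_preconnected (h i)
  tfae_have 3 → 1 := isInseparableGraph_of_T1Component_eq_bot
  tfae_finish
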